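/- Let $M$ be a paracompact, arcwise connected space whose open contractible subsets form a base of the topology, and let $K$ be the poset of open contractible subsets of $M$, ordered by inclusion. Assume that $M$ is locally compact and Hausdorff (for instance a manifold) or, more generally, that $M$ has a locally finite cover by open contractible sets. Let $G$ be a group. A Čech cocycle of the dual poset $K^\circ$ is a family $\xi=\{\xi_{aa'}\}_{a,a'\in K}$ of maps $\xi_{aa'}:V^\circ_{aa'}\to G$, where $V^\circ_a=\{o\in K: o\subseteq a\}$, $V^\circ_{aa'}=V^\circ_a\cap V^\circ_{a'}$, each locally constant in the sense that $\xi_{aa'}(o)=\xi_{aa'}(o')$ whenever $o\subseteq o'$, and with $\xi_{a''a'}(o)\,\xi_{a'a}(o)=\xi_{a''a}(o)$ for $o\in V^\circ_a\cap V^\circ_{a'}\cap V^\circ_{a''}$. Two such cocycles $\xi',\xi$ are equivalent if there are locally constant $u_a:V^\circ_a\to G$ with $\xi'_{aa'}(o)\,u_{a'}(o)=u_a(o)\,\xi_{aa'}(o)$ for $o\in V^\circ_{aa'}$; $\mathrm H^1_c(K^\circ,G)$ is the set of equivalence classes. A locally constant cocycle on $M$ is a pair $(A,f)$, where $A\subseteq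 K$ is a locally finite cover of $M$ and $f=\{f_{a'a}:a'\cap a\to G\}_{a,a'\in A}$ is a family of locally constant maps with $f_{a''a'}(x)f_{a'a}(x)=f_{a''a}(x)$ for $x\in a\cap a'\cap a''$. Two such cocycles $(\tilde A,\tilde f)$, $(A,f)$ are equivalent if there are locally constant maps $v_{a\tilde a}:a\cap\tilde a\to G$ ($a\in A$, $\tilde a\in\tilde A$) with $v_{a\tilde a}(x)\tilde f_{\tilde a\tilde a'}(x)=f_{aa'}(x)v_{a'\tilde a'}(x)$ for $x\in a\cap a'\cap\tilde a\cap\tilde a'$; $\mathrm H^1_{lc}(M,G)$ is the set of equivalence classes. For a Čech cocycle $\xi$ of $K^\circ$ and a locally finite cover $A\subseteq K$ of $M$, let $\xi^{\mathbf{lc}}_{aa'}(x):=\xi_{aa'}(o)$ for $a,a'\in A$, $x\in a\cap a'$ and any $o\in V^\circ_{aa'}$ with $x\in o$; this is well defined and $(A,\xi^{\mathbf{lc}})$ is a locally constant cocycle. Then locally finite covers $A\subseteq K$ of $M$ exist, and there is a unique bijection $\mathrm H^1_c(K^\circ,G)\to\mathrm H^1_{lc}(M,G)$ that sends the class of $\xi$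 to the class of $(A,\xi^{\mathbf{lc}})$, for every Čech cocycle $\xi$ of $K^\circ$ and every locally finite cover $A\subseteq K$ of $M$. -/

import Mathlib

universe u v

namespace PosetCech

open TopologicalSpace Topology

/-! ## Čech cohomology of a poset -/

section Poset

variable {P : Type u} [PartialOrder P]

/-- The element `V_a` of the fundamental covering of a poset: the smallest open set containing `a`
for the Alexandroff topology, that is `V_a = {o | a ≤ o}`. In the dual poset this becomes
`V°_a = {o | a ≤° o} = {o | o ≤ a}`. -/
def fundOpen (a : P) : Set P := {o | a ≤ o}

/-- A function on a subset of a poset is locally constant if it takes the same value on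
comparable elements. -/
def PosetLocConst {G : Type v} {S : Set P} (f : S → G) : Prop :=
  ∀ o o' : S, (o : P) ≤ o' → f o = f o'

variable (P) in
/-- Čech 1-cocycles of a poset `P` with values in a group `G`: families of locally constant maps
`ξ_{a a'} : V_a ∩ V_{a'} → G` with `ξ_{a'' a'} ξ_{a' a} = ξ_{a'' a}` on `V_a ∩ V_{a'} ∩ V_{a''}`. -/
structure CechCocycle (G : Type v) [Group G] where
  toFun : ∀ a a' : P, ↥(fundOpen a ∩ fundOpen a') → G
  locConst : ∀ a a' : P, PosetLocConst (toFun a a')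
  cocycle : ∀ (a a' a'' o : P) (h : o ∈ fundOpen a) (h' : o ∈ fundOpen a') (h'' : o ∈ fundOpen a''),
    toFun a'' a' ⟨o, h'', h'⟩ * toFun a' a ⟨o, h', h⟩ = toFun a'' a ⟨o, h'', h⟩

variable {G : Type v} [Group G]

/-- `ξ'` is equivalent to `ξ` if there are locally constant `u_a : V_a → G` such that
`ξ'_{a a'} u_{a'} = u_a ξ_{a a'}` on `V_a ∩ V_{a'}`. -/
def CechCocycle.Equivalent (ξ' ξ : CechCocycle P G) : Prop :=
  ∃ c : ∀ a : P, ↥(fundOpen a) → G, (∀ a, PosetLocConst (c a)) ∧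
    ∀ (a a' o : P) (h : o ∈ fundOpen a) (h' : o ∈ fundOpen a'),
      ξ'.toFun a a' ⟨o, h, h'⟩ * c a' ⟨o, h'⟩ = c a ⟨o, h⟩ * ξ.toFun a a' ⟨o, h, h'⟩

theorem CechCocycle.equivalence : Equivalence (CechCocycle.Equivalent (P := P) (G := G)) where
  refl ξ := ⟨fun _ _ => 1, fun _ _ _ _ => rfl, by intros; simp⟩
  symm := by
    rintro ξ' ξ ⟨c, hc, h⟩
    refine ⟨fun a o => (c a o)⁻¹, fun a o o' ho => congrArg (·⁻¹) (hc a o o' ho), ?_⟩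
    intro a a' o ha ha'
    have := h a a' o ha ha'
    rw [mul_inv_eq_iff_eq_mul, mul_assoc, eq_inv_mul_iff_mul_eq, this]
  trans := by
    rintro ξ₁ ξ₂ ξ₃ ⟨c, hc, h⟩ ⟨d, hd, k⟩
    refine ⟨fun a o => c a o * d a o, fun a o o' ho =>
      congrArg₂ (· * ·) (hc a o o' ho) (hd a o o' ho), ?_⟩
    intro a a' o ha ha'
    rw [← mul_assoc, h a a' o ha ha', mul_assoc, k a a' o ha ha', mul_assoc]

instance CechCocycle.setoid : Setoid (CechCocycle P G) :=
  ⟨CechCocycle.Equivalent, CechCocycle.equivalence⟩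

variable (P G) in
/-- The first Čech cohomology `H¹_c(P, G)` of a poset. -/
def CechH1 : Type (max u v) := Quotient (CechCocycle.setoid (P := P) (G := G))

/-- The cohomology class of a Čech cocycle. -/
def CechCocycle.toH1 (ξ : CechCocycle P G) : CechH1 P G := Quotient.mk _ ξ

end Poset

/-! ## Locally constant cohomology of a space -/

section Space

variable (M : Type u) [TopologicalSpace M]

/-- The poset `K` of open contractible subsets of `M`, ordered under inclusion. -/
abbrev ContractibleOpens : Type u := {U : Opens M // ContractibleSpace U}

/-- The open contractible subsets of `M` form a base of the topology of `M`. -/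
def HasContractibleOpenBasis : Prop :=
  IsTopologicalBasis {U : Set M | IsOpen U ∧ ContractibleSpace U}

variable {M}

/-- The subset of `M` underlying an element of `K`. -/
abbrev ContractibleOpens.carrier (a : ContractibleOpens M) : Set M := (a.1 : Set M)

variable (M) in
/-- Locally finite covers of `M` by open contractible sets. -/
structure ContractibleCover where
  sets : Set (ContractibleOpens M)
  locallyFinite : LocallyFinite fun a : sets => a.1.carrier
  covers : ∀ x : M, ∃ a ∈ sets, x ∈ a.carrier

variable (M) in
/-- Locally constant 1-cocycles `(A, f)` on `M` with values in a group `G`: `A` is a locally finite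
cover of `M` by open contractible sets and `f` is a family of locally constant maps
`f_{a' a} : a' ∩ a → G` with `f_{a'' a'} f_{a' a} = f_{a'' a}` on `a ∩ a' ∩ a''`. -/
structure LCCocycle (G : Type v) [Group G] where
  cover : ContractibleCover M
  toFun : ∀ a' a : cover.sets, ↥(a'.1.carrier ∩ a.1.carrier) → G
  locConst : ∀ a' a, IsLocallyConstant (toFun a' a)
  cocycle : ∀ (a a' a'' : cover.sets) (x : M) (h : x ∈ a.1.carrier) (h' : x ∈ a'.1.carrier)
    (h'' : x ∈ a''.1.carrier),
    toFun a'' a' ⟨x, h'', h'⟩ * toFun a' a ⟨x, h', h⟩ = toFun a'' a ⟨x, h'', h⟩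

variable {G : Type v} [Group G]

/-- `(B, g)` is equivalent to `(A, f)` if there are locally constant maps
`v_{a b} : a ∩ b → G`, for `a ∈ A` and `b ∈ B`, with
`v_{a b} g_{b b'} = f_{a a'} v_{a' b'}` on `a ∩ a' ∩ b ∩ b'`. -/
def LCCocycle.Equivalent (g f : LCCocycle M G) : Prop :=
  ∃ t : ∀ (a : f.cover.sets) (b : g.cover.sets), ↥(a.1.carrier ∩ b.1.carrier) → G,
    (∀ a b, IsLocallyConstant (t a b)) ∧
    ∀ (a a' : f.cover.sets) (b b' : g.cover.sets) (x : M)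
      (ha : x ∈ a.1.carrier) (ha' : x ∈ a'.1.carrier)
      (hb : x ∈ b.1.carrier) (hb' : x ∈ b'.1.carrier),
      t a b ⟨x, ha, hb⟩ * g.toFun b b' ⟨x, hb, hb'⟩ =
        f.toFun a a' ⟨x, ha, ha'⟩ * t a' b' ⟨x, ha', hb'⟩

theorem LCCocycle.toFun_self (f : LCCocycle M G) (a : f.cover.sets) (x : M)
    (h : x ∈ a.1.carrier) : f.toFun a a ⟨x, h, h⟩ = 1 := by
  simpa using f.cocycle a a a x h h h

theorem LCCocycle.equivalence : Equivalence (LCCocycle.Equivalent (M := M) (G := G)) where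
  refl f := ⟨f.toFun, f.locConst, fun a a' b b' x ha ha' hb hb' => by
    rw [f.cocycle _ _ _ x hb' hb ha, f.cocycle _ _ _ x hb' ha' ha]⟩
  symm := by
    rintro g f ⟨t, ht, h⟩
    refine ⟨fun b a x => (t a b ⟨x.1, x.2.2, x.2.1⟩)⁻¹, fun b a => ?_, ?_⟩
    · refine ((ht a b).comp_continuous (f := fun x : ↥(b.1.carrier ∩ a.1.carrier) =>
        (⟨x.1, x.2.2, x.2.1⟩ : ↥(a.1.carrier ∩ b.1.carrier))) (by fun_prop)).inv
    · intro b b' a a' x hb hb' ha ha'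
      have := h a a' b b' x ha ha' hb hb'
      rw [eq_mul_inv_iff_mul_eq, mul_assoc, inv_mul_eq_iff_eq_mul, this]
  trans := by
    rintro k g f ⟨s, hs, h₁⟩ ⟨t, ht, h₂⟩
    choose β hβ hxβ using g.cover.covers
    have indep : ∀ (a : f.cover.sets) (c : k.cover.sets) (b b' : g.cover.sets) (x : M)
        (ha : x ∈ a.1.carrier) (hc : x ∈ c.1.carrier)
        (hb : x ∈ b.1.carrier) (hb' : x ∈ b'.1.carrier),
        t a b ⟨x, ha, hb⟩ * s b c ⟨x, hb, hc⟩ = t a b' ⟨x, ha, hb'⟩ * s b' c ⟨x, hb', hc⟩ := by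
      intro a c b b' x ha hc hb hb'
      have e₁ := h₁ b b' c c x hb hb' hc hc
      have e₂ := h₂ a a b b' x ha ha hb hb'
      rw [k.toFun_self c x hc, mul_one] at e₁
      rw [f.toFun_self a x ha, one_mul] at e₂
      rw [e₁, ← mul_assoc, e₂]
    refine ⟨fun a c x => t a ⟨β x.1, hβ _⟩ ⟨x.1, x.2.1, hxβ _⟩ *
      s ⟨β x.1, hβ _⟩ c ⟨x.1, hxβ _, x.2.2⟩, fun a c => ?_, ?_⟩
    · rw [IsLocallyConstant.iff_exists_open]
      rintro ⟨x, hxa, hxc⟩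
      obtain ⟨U, hU, hxU, hU'⟩ := (IsLocallyConstant.iff_exists_open _).1
        (ht a ⟨β x, hβ x⟩) ⟨x, hxa, hxβ x⟩
      obtain ⟨W, hW, hxW, hW'⟩ := (IsLocallyConstant.iff_exists_open _).1
        (hs ⟨β x, hβ x⟩ c) ⟨x, hxβ x, hxc⟩
      obtain ⟨U', hUo, rfl⟩ := isOpen_induced_iff.1 hU
      obtain ⟨W', hWo, rfl⟩ := isOpen_induced_iff.1 hW
      refine ⟨Subtype.val ⁻¹' (U' ∩ W' ∩ (β x).carrier),
        ((hUo.inter hWo).inter (β x).1.isOpen).preimage continuous_subtype_val,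
        ⟨⟨hxU, hxW⟩, hxβ x⟩, ?_⟩
      rintro ⟨y, hya, hyc⟩ ⟨⟨hyU, hyW⟩, hyβ⟩
      refine (indep a c ⟨β y, hβ y⟩ ⟨β x, hβ x⟩ y hya hyc (hxβ y) hyβ).trans ?_
      have e₁ := hU' ⟨y, hya, hyβ⟩ hyU
      have e₂ := hW' ⟨y, hyβ, hyc⟩ hyW
      dsimp only
      rw [e₁, e₂]
    · intro a a' c c' x ha ha' hc hc'
      have e₁ := h₁ ⟨β x, hβ x⟩ ⟨β x, hβ x⟩ c c' x (hxβ x) (hxβ x) hc hc'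
      have e₂ := h₂ a a' ⟨β x, hβ x⟩ ⟨β x, hβ x⟩ x ha ha' (hxβ x) (hxβ x)
      rw [g.toFun_self _ x (hxβ x), one_mul] at e₁
      rw [g.toFun_self _ x (hxβ x), mul_one] at e₂
      dsimp only
      rw [mul_assoc, e₁, ← mul_assoc, e₂, mul_assoc]

instance LCCocycle.setoid : Setoid (LCCocycle M G) :=
  ⟨LCCocycle.Equivalent, LCCocycle.equivalence⟩

variable (M G) in
/-- The first locally constant cohomology `H¹_lc(M, G)`. -/
def LCH1 : Type (max u v) := Quotient (LCCocycle.setoid (M := M) (G := G))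

/-- The cohomology class of a locally constant cocycle. -/
def LCCocycle.toH1 (f : LCCocycle M G) : LCH1 M G := Quotient.mk _ f

/-! ## From Čech cocycles of the dual poset to locally constant cocycles -/

theorem HasContractibleOpenBasis.exists_mem (hM : HasContractibleOpenBasis M)
    (a a' : ContractibleOpens M) (x : M) (hx : x ∈ a.carrier ∩ a'.carrier) :
    ∃ o : ContractibleOpens M, o ≤ a ∧ o ≤ a' ∧ x ∈ o.carrier := by
  obtain ⟨U, ⟨hU, hUc⟩, hxU, hUsub⟩ := hM.exists_subset_of_mem_open hx
    (a.1.isOpen.inter a'.1.isOpen)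
  exact ⟨⟨⟨U, hU⟩, hUc⟩, fun y hy => (hUsub hy).1, fun y hy => (hUsub hy).2, hxU⟩

/-- The function `ξ^lc_{a a'} : a ∩ a' → G`, whose value at `x` is `ξ_{a a'}(o)` for a chosen
open contractible `o ⊆ a ∩ a'` containing `x`; by `lcFun_eq` the choice does not matter. -/
noncomputable def lcFun (hM : HasContractibleOpenBasis M)
    (ξ : CechCocycle (ContractibleOpens M)ᵒᵈ G) (a a' : ContractibleOpens M)
    (x : ↥(a.carrier ∩ a'.carrier)) : G :=
  ξ.toFun (OrderDual.toDual a) (OrderDual.toDual a')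
    ⟨OrderDual.toDual (hM.exists_mem a a' x x.2).choose,
      (hM.exists_mem a a' x x.2).choose_spec.1, (hM.exists_mem a a' x x.2).choose_spec.2.1⟩

/-- `ξ^lc_{a a'}(x) = ξ_{a a'}(o)` for every open contractible `o ⊆ a ∩ a'` with `x ∈ o`. -/
theorem lcFun_eq (hM : HasContractibleOpenBasis M)
    (ξ : CechCocycle (ContractibleOpens M)ᵒᵈ G) (a a' o : ContractibleOpens M)
    (h : o ≤ a) (h' : o ≤ a') (x : M) (hx : x ∈ o.carrier) :
    lcFun hM ξ a a' ⟨x, h hx, h' hx⟩ =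
      ξ.toFun (OrderDual.toDual a) (OrderDual.toDual a') ⟨OrderDual.toDual o, h, h'⟩ := by
  have hs := (hM.exists_mem a a' x ⟨h hx, h' hx⟩).choose_spec
  obtain ⟨q, hq, hq', -⟩ := hM.exists_mem _ o x ⟨hs.2.2, hx⟩
  have hqa : q ≤ a := hq'.trans h
  have hqa' : q ≤ a' := hq'.trans h'
  have e₁ := ξ.locConst (OrderDual.toDual a) (OrderDual.toDual a')
    ⟨OrderDual.toDual o, h, h'⟩ ⟨OrderDual.toDual q, hqa, hqa'⟩ hq'
  have e₂ := ξ.locConst (OrderDual.toDual a) (OrderDual.toDual a')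
    ⟨OrderDual.toDual (hM.exists_mem a a' x ⟨h hx, h' hx⟩).choose, hs.1, hs.2.1⟩
    ⟨OrderDual.toDual q, hqa, hqa'⟩ hq
  exact e₂.trans e₁.symm

/-- The locally constant cocycle `(A, ξ^lc)` attached to a Čech cocycle `ξ` of the dual poset `K°`
and a locally finite cover `A` by open contractible sets. -/
noncomputable def CechCocycle.lc (hM : HasContractibleOpenBasis M) (A : ContractibleCover M)
    (ξ : CechCocycle (ContractibleOpens M)ᵒᵈ G) : LCCocycle M G where
  cover := A
  toFun a a' := lcFun hM ξ a.1 a'.1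
  locConst a a' := by
    rw [IsLocallyConstant.iff_exists_open]
    rintro ⟨x, hx⟩
    obtain ⟨o, h, h', hxo⟩ := hM.exists_mem a.1 a'.1 x hx
    refine ⟨Subtype.val ⁻¹' o.carrier, o.1.isOpen.preimage continuous_subtype_val, hxo, ?_⟩
    rintro ⟨y, hy⟩ hyo
    exact (lcFun_eq hM ξ a.1 a'.1 o h h' y hyo).trans (lcFun_eq hM ξ a.1 a'.1 o h h' x hxo).symm
  cocycle a a' a'' x h h' h'' := by
    obtain ⟨p, hp, hp', hxp⟩ := hM.exists_mem a.1 a'.1 x ⟨h, h'⟩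
    obtain ⟨o, ho, ho'', hxo⟩ := hM.exists_mem p a''.1 x ⟨hxp, h''⟩
    have e₁ := lcFun_eq hM ξ a''.1 a'.1 o ho'' (ho.trans hp') x hxo
    have e₂ := lcFun_eq hM ξ a'.1 a.1 o (ho.trans hp') (ho.trans hp) x hxo
    have e₃ := lcFun_eq hM ξ a''.1 a.1 o ho'' (ho.trans hp) x hxo
    rw [e₁, e₂, e₃]
    exact ξ.cocycle _ _ _ (OrderDual.toDual o) (ho.trans hp) (ho.trans hp') ho''

end Space

end PosetCech

/-! A locally constant cocycle `(A, f)` is the gluing data of a principal bundle with discrete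
fibre `G`, that is, of a covering of `M`. An open contractible set `a` is simply connected, and
locally path connected by the hypothesis on the base of the topology, so the inclusion `a → M`
lifts to that covering: over `a` the cocycle is a coboundary, `f_{c c'} s^a_{c'} = s^a_c` for
locally constant `s^a_c : a ∩ c → G` (`LCCocycle.exists_trivialization`). The functions
`(s^a_c)⁻¹ s^b_c` do not depend on `c`, hence glue to a locally constant function on `a ∩ b`; being
constant on the connected sets `o ⊆ a ∩ b`, they form a Čech cocycle `ξ` of the dual poset, and
`s` itself is an equivalence between `(A, ξ^lc)` and `(A, f)`. This is surjectivity.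

On the other side, a locally constant function on `V°_a` is constant because `a` is the greatest
element of `V°_a`, so an equivalence of Čech cocycles is a family of constants `k_a ∈ G`
(`CechCocycle.equivalent_iff_lcFun`). An equivalence `t` of `(A, ξ'^lc)` with `(A, ξ^lc)` yields
such constants because each `a` is connected: the functions `ξ'_{a c} t_{c c}⁻¹ ξ_{c a}` on `a ∩ c` do not
depend on `c ∈ A`, so they glue to a locally constant, hence constant, function on `a`. This is
injectivity. A change of the cover `A` is absorbed by the equivalence `t_{a b} = ξ^lc_{a b}`.

Locally finite covers by open contractible sets exist in the locally compact Hausdorff case because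
a connected, locally compact, paracompact space is σ-compact, and in a locally compact σ-compact
Hausdorff space any base admits a locally finite subfamily that still covers. -/

namespace PosetCech

open TopologicalSpace Topology Set Filter

/-! ### Existence of locally finite contractible covers -/

/-- Starting from a point, repeatedly add the compact sets attached to those members of a locally
finite cover that meet the compact set reached so far. The union of the resulting sequence is
open and closed. -/
theorem sigmaCompactSpace_of_paracompact_connected (X : Type*) [TopologicalSpace X]
    [ParacompactSpace X] [WeaklyLocallyCompactSpace X] [ConnectedSpace X] :
    SigmaCompactSpace X := by
  choose K hK hKx using fun x : X => exists_compact_mem_nhds x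
  obtain ⟨t, hto, htc, htf, htK⟩ := precise_refinement (fun x => interior (K x))
    (fun x => isOpen_interior)
    (eq_univ_of_forall fun x => mem_iUnion.2 ⟨x, mem_interior_iff_mem_nhds.2 (hKx x)⟩)
  have hcov : ∀ x, ∃ i, x ∈ t i := fun x => mem_iUnion.1 (htc ▸ mem_univ x)
  let next : Set X → Set X := fun C => ⋃ i ∈ {i | (t i ∩ C).Nonempty}, K i
  have hnext : ∀ C, IsCompact C → IsCompact (next C) := fun C hC =>
    (htf.finite_nonempty_inter_compact hC).isCompact_biUnion fun i _ => hK i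
  have hsub : ∀ C i, (t i ∩ C).Nonempty → t i ⊆ next C := fun C i h =>
    ((htK i).trans interior_subset).trans (subset_biUnion_of_mem (u := K) h)
  obtain ⟨x₀⟩ := (inferInstance : Nonempty X)
  let L : ℕ → Set X := fun n => next^[n] {x₀}
  have hL : ∀ n, L (n + 1) = next (L n) := fun n => Function.iterate_succ_apply' _ _ _
  have hLc : ∀ n, IsCompact (L n) := by
    intro n
    induction n with
    | zero => exact isCompact_singleton
    | succ n ih => rw [hL]; exact hnext _ ih
  have hstep : ∀ n i, (t i ∩ L n).Nonempty → t i ⊆ ⋃ n, L n := fun n i h =>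
    (hsub _ i h).trans ((hL n).symm ▸ subset_iUnion L (n + 1))
  have hclopen : IsClopen (⋃ n, L n) := by
    constructor
    · refine isClosed_of_closure_subset fun x hx => ?_
      obtain ⟨i, hi⟩ := hcov x
      obtain ⟨y, hyi, hy⟩ := mem_closure_iff.1 hx (t i) (hto i) hi
      obtain ⟨n, hn⟩ := mem_iUnion.1 hy
      exact hstep n i ⟨y, hyi, hn⟩ hi
    · refine isOpen_iff_mem_nhds.2 fun x hx => ?_
      obtain ⟨n, hn⟩ := mem_iUnion.1 hx
      obtain ⟨i, hi⟩ := hcov x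
      exact mem_of_superset ((hto i).mem_nhds hi) (hstep n i ⟨x, hi, hn⟩)
  exact ⟨⟨L, hLc, hclopen.eq_univ ⟨x₀, mem_iUnion.2 ⟨0, mem_singleton x₀⟩⟩⟩⟩

variable {M : Type u} [TopologicalSpace M]

theorem HasContractibleOpenBasis.nonempty_contractibleCover (hM : HasContractibleOpenBasis M)
    [T2Space M] [WeaklyLocallyCompactSpace M] [SigmaCompactSpace M] :
    Nonempty (ContractibleCover M) := by
  obtain ⟨α, c, r, hr, hcov, hfin⟩ :=
    refinement_of_locallyCompact_sigmaCompact_of_nhds_basis.{u, u} fun x : M => hM.nhds_hasBasis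
  let U : α → ContractibleOpens M := fun i => ⟨⟨r i, (hr i).1.1⟩, (hr i).1.2⟩
  refine ⟨⟨range U, ?_, fun x => ?_⟩⟩
  · exact LocallyFinite.of_comp_surjective (g := rangeFactorization U)
      rangeFactorization_surjective hfin
  · obtain ⟨i, hi⟩ := mem_iUnion.1 (hcov ▸ mem_univ x)
    exact ⟨U i, mem_range_self i, hi⟩

/-! ### Locally constant functions on subsets -/

theorem isLocallyConstant_subtype_iff {α : Type*} {S : Set M} {f : S → α} :
    IsLocallyConstant f ↔
      ∀ x (hx : x ∈ S), ∀ᶠ y in 𝓝 x, ∀ hy : y ∈ S, f ⟨y, hy⟩ = f ⟨x, hx⟩ := by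
  rw [IsLocallyConstant.iff_eventually_eq, Subtype.forall]
  refine forall₂_congr fun x hx => ?_
  rw [nhds_subtype_eq_comap, eventually_comap]
  refine eventually_congr (Eventually.of_forall fun y => ?_)
  exact ⟨fun h hy => h ⟨y, hy⟩ rfl, fun h z hz => by subst hz; exact h z.2⟩

theorem ContractibleOpens.apply_eq_of_isLocallyConstant {α : Type*} {S : Set M} {f : S → α}
    (hf : IsLocallyConstant f) (o : ContractibleOpens M) (ho : o.carrier ⊆ S) {x y : M}
    (hx : x ∈ o.carrier) (hy : y ∈ o.carrier) : f ⟨x, ho hx⟩ = f ⟨y, ho hy⟩ := by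
  have : ContractibleSpace o.carrier := o.2
  exact (hf.comp_continuous (continuous_inclusion ho)).apply_eq_of_preconnectedSpace
    ⟨x, hx⟩ ⟨y, hy⟩

theorem ContractibleOpens.nonempty (o : ContractibleOpens M) : o.carrier.Nonempty :=
  have : ContractibleSpace o.carrier := o.2
  nonempty_coe_sort.1 inferInstance

/-- A point chosen in an open contractible set. -/
noncomputable def ContractibleOpens.point (o : ContractibleOpens M) : M := o.nonempty.some

theorem ContractibleOpens.point_mem (o : ContractibleOpens M) : o.point ∈ o.carrier :=
  o.nonempty.some_mem

/-- The index of a chosen member of the cover containing a given point. -/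
noncomputable def ContractibleCover.index (A : ContractibleCover M) (x : M) : A.sets :=
  ⟨(A.covers x).choose, (A.covers x).choose_spec.1⟩

theorem ContractibleCover.mem_index (A : ContractibleCover M) (x : M) :
    x ∈ (A.index x).1.carrier :=
  (A.covers x).choose_spec.2

/-- Locally constant functions on the sets `S ∩ c`, for `c` in a cover, that agree on overlaps
glue to a locally constant function on `S`. -/
theorem ContractibleCover.exists_glue {α : Type*} (A : ContractibleCover M) {S : Set M}
    (h : ∀ c : A.sets, ↥(S ∩ c.1.carrier) → α) (hloc : ∀ c, IsLocallyConstant (h c))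
    (hagree : ∀ (c c' : A.sets) (x : M) (hx : x ∈ S) (hc : x ∈ c.1.carrier)
      (hc' : x ∈ c'.1.carrier), h c ⟨x, hx, hc⟩ = h c' ⟨x, hx, hc'⟩) :
    ∃ F : S → α, IsLocallyConstant F ∧
      ∀ (c : A.sets) (x : M) (hx : x ∈ S) (hc : x ∈ c.1.carrier), F ⟨x, hx⟩ = h c ⟨x, hx, hc⟩ := by
  refine ⟨fun x => h (A.index x) ⟨x, x.2, A.mem_index x⟩, ?_,
    fun c x hx hc => hagree _ c x hx (A.mem_index x) hc⟩
  refine isLocallyConstant_subtype_iff.2 fun x hx => ?_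
  filter_upwards [(A.index x).1.1.isOpen.mem_nhds (A.mem_index x),
    isLocallyConstant_subtype_iff.1 (hloc (A.index x)) x ⟨hx, A.mem_index x⟩] with y hy hy' hyS
  exact (hagree _ (A.index x) y hyS (A.mem_index y) hy).trans (hy' ⟨hyS, hy⟩)

variable {G : Type v} [Group G]

/-! ### Triviality of locally constant cocycles over contractible sets -/

theorem HasContractibleOpenBasis.locallyPathConnectedSpace (hM : HasContractibleOpenBasis M) :
    LocallyPathConnectedSpace M :=
  .of_bases (fun _ => hM.nhds_hasBasis) fun _ s hs =>
    have : ContractibleSpace s := hs.1.2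
    isPathConnected_iff_pathConnectedSpace.2 inferInstance

open Classical in
/-- The principal bundle of a locally constant cocycle, as gluing data. The fibre `G` carries
whatever discrete topology is given; outside of `i ∩ j` the coordinate change is the identity. -/
noncomputable def LCCocycle.bundleCore [TopologicalSpace G] [DiscreteTopology G]
    (f : LCCocycle M G) : FiberBundleCore f.cover.sets M G where
  baseSet i := i.1.carrier
  isOpen_baseSet i := i.1.1.isOpen
  indexAt := f.cover.index
  mem_baseSet_at := f.cover.mem_index
  coordChange i j x g :=
    if h : x ∈ j.1.carrier ∩ i.1.carrier then f.toFun j i ⟨x, h⟩ * g else g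
  coordChange_self i x hx g := by
    rw [dif_pos ⟨hx, hx⟩, f.toFun_self i x hx, one_mul]
  continuousOn_coordChange i j := by
    rintro ⟨x, g⟩ ⟨⟨hi, hj⟩, -⟩
    have hloc := isLocallyConstant_subtype_iff.1 (f.locConst j i) x ⟨hj, hi⟩
    have hU : ∀ᶠ y in 𝓝 x, y ∈ j.1.carrier ∩ i.1.carrier :=
      (j.1.1.isOpen.inter i.1.1.isOpen).mem_nhds ⟨hj, hi⟩
    have hcont : Continuous fun p : M × G => f.toFun j i ⟨x, hj, hi⟩ * p.2 :=
      (continuous_of_discreteTopology (f := fun g : G => f.toFun j i ⟨x, hj, hi⟩ * g)).comp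
        continuous_snd
    refine (hcont.continuousAt.congr ?_).continuousWithinAt
    filter_upwards [continuous_fst.tendsto (x, g) |>.eventually (hloc.and hU)] with p hp
    rw [dif_pos hp.2, hp.1 hp.2]
  coordChange_comp i j k x hx g := by
    rw [dif_pos ⟨hx.2, hx.1.2⟩, dif_pos ⟨hx.1.2, hx.1.1⟩, dif_pos ⟨hx.2, hx.1.1⟩, ← mul_assoc,
      f.cocycle i j k x hx.1.1 hx.1.2 hx.2]

/-- Over an open contractible set `a` a locally constant cocycle is a coboundary: the inclusion of
`a` lifts to the covering defined by the cocycle, and `s c` is the fibre coordinate of the lift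
in the chart over `c`. -/
theorem LCCocycle.exists_trivialization (hM : HasContractibleOpenBasis M) (f : LCCocycle M G)
    (a : ContractibleOpens M) :
    ∃ s : ∀ c : f.cover.sets, ↥(a.carrier ∩ c.1.carrier) → G, (∀ c, IsLocallyConstant (s c)) ∧
      ∀ (c c' : f.cover.sets) (x : M) (ha : x ∈ a.carrier) (hc : x ∈ c.1.carrier)
        (hc' : x ∈ c'.1.carrier),
        f.toFun c c' ⟨x, hc, hc'⟩ * s c' ⟨x, ha, hc'⟩ = s c ⟨x, ha, hc⟩ := by
  let _ : TopologicalSpace G := ⊥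
  have : DiscreteTopology G := ⟨rfl⟩
  let Z := f.bundleCore
  have hcov : IsCoveringMap (Bundle.TotalSpace.proj : Z.TotalSpace → M) :=
    FiberBundle.isCoveringMap
  have : ContractibleSpace a.carrier := a.2
  have : LocallyPathConnectedSpace M := hM.locallyPathConnectedSpace
  have : LocallyPathConnectedSpace a.carrier := a.1.isOpen.locallyPathConnectedSpace
  obtain ⟨σ, ⟨-, hσ⟩, -⟩ := hcov.existsUnique_continuousMap_lifts
    (⟨Subtype.val, continuous_subtype_val⟩ : C(a.carrier, M)) ⟨a.point, a.point_mem⟩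
    ⟨a.point, (1 : G)⟩ rfl
  have hσ' : ∀ x, (σ x).proj = x := congrFun hσ
  refine ⟨fun c x => (Z.localTriv c (σ ⟨x, x.2.1⟩)).2, fun c => ?_, fun c c' x ha hc hc' => ?_⟩
  · refine (IsLocallyConstant.iff_continuous _).2 (continuous_snd.comp ?_)
    refine (Z.localTriv c).continuousOn.comp_continuous
      (σ.continuous.comp (continuous_inclusion inter_subset_left)) fun x => ?_
    rw [Z.mem_localTriv_source]
    exact (hσ' ⟨x, x.2.1⟩).symm ▸ x.2.2
  · -- the base point of the lift is only propositionally equal to `x`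
    have key : ∀ e : Z.TotalSpace, e.proj = x →
        f.toFun c c' ⟨x, hc, hc'⟩ * (Z.localTriv c' e).2 = (Z.localTriv c e).2 := by
      rintro ⟨y, g⟩ rfl
      have h := Z.coordChange_comp (Z.indexAt y) c' c y ⟨⟨Z.mem_baseSet_at y, hc'⟩, hc⟩ g
      have h' : ∀ g', Z.coordChange c' c y g' = f.toFun c c' ⟨y, hc, hc'⟩ * g' := fun g' =>
        dif_pos (⟨hc, hc'⟩ : y ∈ c.1.carrier ∩ c'.1.carrier)
      rw [h'] at h
      exact h
    exact key _ (hσ' ⟨x, ha⟩)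

/-! ### The functions attached to a Čech cocycle -/

theorem lcFun_isLocallyConstant (hM : HasContractibleOpenBasis M)
    (ξ : CechCocycle (ContractibleOpens M)ᵒᵈ G) (a a' : ContractibleOpens M) :
    IsLocallyConstant (lcFun hM ξ a a') := by
  refine isLocallyConstant_subtype_iff.2 fun x hx => ?_
  obtain ⟨o, h, h', hxo⟩ := hM.exists_mem a a' x hx
  filter_upwards [o.1.isOpen.mem_nhds hxo] with y hyo hy
  exact (lcFun_eq hM ξ a a' o h h' y hyo).trans (lcFun_eq hM ξ a a' o h h' x hxo).symm

theorem lcFun_mul (hM : HasContractibleOpenBasis M)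
    (ξ : CechCocycle (ContractibleOpens M)ᵒᵈ G) {a a' a'' : ContractibleOpens M} {x : M}
    (h : x ∈ a.carrier) (h' : x ∈ a'.carrier) (h'' : x ∈ a''.carrier) :
    lcFun hM ξ a'' a' ⟨x, h'', h'⟩ * lcFun hM ξ a' a ⟨x, h', h⟩ = lcFun hM ξ a'' a ⟨x, h'', h⟩ := by
  obtain ⟨p, hp, hp', hxp⟩ := hM.exists_mem a a' x ⟨h, h'⟩
  obtain ⟨o, ho, ho'', hxo⟩ := hM.exists_mem p a'' x ⟨hxp, h''⟩
  have e₁ := lcFun_eq hM ξ a'' a' o ho'' (ho.trans hp') x hxo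
  have e₂ := lcFun_eq hM ξ a' a o (ho.trans hp') (ho.trans hp) x hxo
  have e₃ := lcFun_eq hM ξ a'' a o ho'' (ho.trans hp) x hxo
  rw [e₁, e₂, e₃]
  exact ξ.cocycle _ _ _ (OrderDual.toDual o) (ho.trans hp) (ho.trans hp') ho''

/-- A Čech cocycle of the dual poset from a cocycle of locally constant functions on all
intersections `a ∩ b` of open contractible sets: its value on `o ⊆ a ∩ b` is the constant value of
the function on the connected set `o`. -/
noncomputable def CechCocycle.ofLocConst
    (F : ∀ a b : ContractibleOpens M, ↥(a.carrier ∩ b.carrier) → G)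
    (hF : ∀ a b, IsLocallyConstant (F a b))
    (hmul : ∀ (a a' a'' : ContractibleOpens M) (x : M) (h : x ∈ a.carrier) (h' : x ∈ a'.carrier)
      (h'' : x ∈ a''.carrier),
      F a'' a' ⟨x, h'', h'⟩ * F a' a ⟨x, h', h⟩ = F a'' a ⟨x, h'', h⟩) :
    CechCocycle (ContractibleOpens M)ᵒᵈ G where
  toFun a b o := F (OrderDual.ofDual a) (OrderDual.ofDual b)
    ⟨(OrderDual.ofDual o.1).point, o.2.1 (OrderDual.ofDual o.1).point_mem,
      o.2.2 (OrderDual.ofDual o.1).point_mem⟩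
  locConst _ _ o o' h :=
    -- in the dual poset `o ≤ o'` says that the open set `o'` lies inside `o`
    (OrderDual.ofDual o.1).apply_eq_of_isLocallyConstant (hF _ _)
      (fun _ hy => ⟨o.2.1 hy, o.2.2 hy⟩) (OrderDual.ofDual o.1).point_mem
      (h (OrderDual.ofDual o'.1).point_mem)
  cocycle _ _ _ o h h' h'' := hmul _ _ _ _ (h (OrderDual.ofDual o).point_mem)
    (h' (OrderDual.ofDual o).point_mem) (h'' (OrderDual.ofDual o).point_mem)

theorem lcFun_ofLocConst (hM : HasContractibleOpenBasis M)
    (F : ∀ a b : ContractibleOpens M, ↥(a.carrier ∩ b.carrier) → G)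
    (hF : ∀ a b, IsLocallyConstant (F a b))
    (hmul : ∀ (a a' a'' : ContractibleOpens M) (x : M) (h : x ∈ a.carrier) (h' : x ∈ a'.carrier)
      (h'' : x ∈ a''.carrier),
      F a'' a' ⟨x, h'', h'⟩ * F a' a ⟨x, h', h⟩ = F a'' a ⟨x, h'', h⟩)
    (a b : ContractibleOpens M) : lcFun hM (.ofLocConst F hF hmul) a b = F a b := by
  funext ⟨x, hx⟩
  obtain ⟨o, h, h', hxo⟩ := hM.exists_mem a b x hx
  have e := lcFun_eq hM (.ofLocConst F hF hmul) a b o h h' x hxo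
  have hsub : o.carrier ⊆ a.carrier ∩ b.carrier := fun _ hy => ⟨h hy, h' hy⟩
  have e' := o.apply_eq_of_isLocallyConstant (hF a b) hsub o.point_mem hxo
  exact e.trans e'

/-- Equivalences of Čech cocycles of the dual poset are families of constants, since `a` is the
greatest open set in `V°_a`. -/
theorem CechCocycle.equivalent_iff_lcFun (hM : HasContractibleOpenBasis M)
    (ξ' ξ : CechCocycle (ContractibleOpens M)ᵒᵈ G) :
    ξ'.Equivalent ξ ↔ ∃ k : ContractibleOpens M → G,
      ∀ (a a' : ContractibleOpens M) (x : ↥(a.carrier ∩ a'.carrier)),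
        lcFun hM ξ' a a' x * k a' = k a * lcFun hM ξ a a' x := by
  constructor
  · rintro ⟨c, hc, h⟩
    refine ⟨fun a => c (OrderDual.toDual a) ⟨OrderDual.toDual a, le_refl (OrderDual.toDual a)⟩, ?_⟩
    rintro a a' ⟨x, hx⟩
    obtain ⟨o, ho, ho', hxo⟩ := hM.exists_mem a a' x hx
    have e₁ := lcFun_eq hM ξ' a a' o ho ho' x hxo
    have e₂ := lcFun_eq hM ξ a a' o ho ho' x hxo
    have e₃ := hc (OrderDual.toDual a) ⟨OrderDual.toDual a, le_refl (OrderDual.toDual a)⟩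
      ⟨OrderDual.toDual o, ho⟩ ho
    have e₄ := hc (OrderDual.toDual a') ⟨OrderDual.toDual a', le_refl (OrderDual.toDual a')⟩
      ⟨OrderDual.toDual o, ho'⟩ ho'
    dsimp only
    rw [e₁, e₂, e₃, e₄]
    exact h (OrderDual.toDual a) (OrderDual.toDual a') (OrderDual.toDual o) ho ho'
  · rintro ⟨k, hk⟩
    refine ⟨fun a _ => k (OrderDual.ofDual a), fun _ _ _ _ => rfl, fun a a' o h h' => ?_⟩
    have hx := (OrderDual.ofDual o).point_mem
    have e := hk (OrderDual.ofDual a) (OrderDual.ofDual a') ⟨_, h hx, h' hx⟩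
    have e₁ := lcFun_eq hM ξ' (OrderDual.ofDual a) (OrderDual.ofDual a') (OrderDual.ofDual o)
      h h' _ hx
    have e₂ := lcFun_eq hM ξ (OrderDual.ofDual a) (OrderDual.ofDual a') (OrderDual.ofDual o)
      h h' _ hx
    rw [e₁, e₂] at e
    exact e

/-! ### The map on cohomology -/

/-- Equivalent Čech cocycles give equivalent locally constant cocycles, whatever the two covers. -/
theorem CechCocycle.Equivalent.lc {ξ' ξ : CechCocycle (ContractibleOpens M)ᵒᵈ G}
    (h : ξ'.Equivalent ξ) (hM : HasContractibleOpenBasis M) (B A : ContractibleCover M) :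
    (ξ'.lc hM B).Equivalent (ξ.lc hM A) := by
  obtain ⟨k, hk⟩ := (equivalent_iff_lcFun hM ξ' ξ).1 h
  refine ⟨fun a b x => (k a.1)⁻¹ * lcFun hM ξ' a.1 b.1 x,
    fun a b => (lcFun_isLocallyConstant hM ξ' a.1 b.1).comp fun g => (k a.1)⁻¹ * g, ?_⟩
  intro a a' b b' x ha ha' hb hb'
  change (k a.1)⁻¹ * lcFun hM ξ' a.1 b.1 _ * lcFun hM ξ' b.1 b'.1 _ =
    lcFun hM ξ a.1 a'.1 _ * ((k a'.1)⁻¹ * lcFun hM ξ' a'.1 b'.1 _)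
  rw [mul_assoc, lcFun_mul hM ξ' hb' hb ha, ← lcFun_mul hM ξ' hb' ha' ha, ← mul_assoc, ← mul_assoc]
  congr 1
  rw [inv_mul_eq_iff_eq_mul, ← mul_assoc, eq_mul_inv_iff_mul_eq]
  exact hk a.1 a'.1 ⟨x, ha, ha'⟩

/-- The constant `k_a` of the equivalence is the value on `a` of the function glued from
`ξ'_{a c} t_{c c}⁻¹ ξ_{c a}`, for `c` in the cover. -/
theorem CechCocycle.equivalent_of_lc (hM : HasContractibleOpenBasis M) (A : ContractibleCover M)
    {ξ' ξ : CechCocycle (ContractibleOpens M)ᵒᵈ G}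
    (h : (ξ'.lc hM A).Equivalent (ξ.lc hM A)) : ξ'.Equivalent ξ := by
  obtain ⟨t, ht, htr⟩ := h
  have htr' : ∀ (c c' : A.sets) (x : M) (hc : x ∈ c.1.carrier) (hc' : x ∈ c'.1.carrier),
      lcFun hM ξ' c.1 c'.1 ⟨x, hc, hc'⟩ * (t c' c' ⟨x, hc', hc'⟩)⁻¹ =
        (t c c ⟨x, hc, hc⟩)⁻¹ * lcFun hM ξ c.1 c'.1 ⟨x, hc, hc'⟩ := fun c c' x hc hc' => by
    rw [mul_inv_eq_iff_eq_mul, mul_assoc, eq_inv_mul_iff_mul_eq]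
    exact htr c c' c c' x hc hc' hc hc'
  have hu := fun a : ContractibleOpens M => A.exists_glue (S := a.carrier)
    (fun c x => lcFun hM ξ' a c.1 x * (t c c ⟨x, x.2.2, x.2.2⟩)⁻¹ *
      lcFun hM ξ c.1 a ⟨x, x.2.2, x.2.1⟩)
    (fun c => by
      have h₁ := lcFun_isLocallyConstant hM ξ' a c.1
      have h₂ := (ht c c).comp_continuous
        (f := fun x : ↥(a.carrier ∩ c.1.carrier) => ⟨x, x.2.2, x.2.2⟩) (by fun_prop)
      have h₃ := (lcFun_isLocallyConstant hM ξ c.1 a).comp_continuous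
        (f := fun x : ↥(a.carrier ∩ c.1.carrier) => ⟨x, x.2.2, x.2.1⟩) (by fun_prop)
      exact (h₁.mul h₂.inv).mul h₃)
    (fun c c' x ha hc hc' => by
      dsimp only
      rw [← lcFun_mul hM ξ ha hc' hc, ← lcFun_mul hM ξ' hc' hc ha, mul_assoc _ _ (t c' c' _)⁻¹,
        htr' c c' x hc hc']
      simp only [mul_assoc])
  choose u hu hux using hu
  refine (equivalent_iff_lcFun hM ξ' ξ).2 ⟨fun a => u a ⟨a.point, a.point_mem⟩, ?_⟩
  rintro a b ⟨x, ha, hb⟩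
  have hc := A.mem_index x
  have ea := (a.apply_eq_of_isLocallyConstant (hu a) subset_rfl a.point_mem ha).trans
    (hux a (A.index x) x ha hc)
  have eb := (b.apply_eq_of_isLocallyConstant (hu b) subset_rfl b.point_mem hb).trans
    (hux b (A.index x) x hb hc)
  dsimp only at ea eb ⊢
  rw [ea, eb, ← mul_assoc, ← mul_assoc, lcFun_mul hM ξ' hc hb ha, mul_assoc _ _ (lcFun hM ξ a b _),
    lcFun_mul hM ξ hb ha hc]

/-- If `s a` trivializes `f` over `a`, then `ξ_{a b}` is glued from `(s a c)⁻¹ * s b c`. -/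
theorem LCCocycle.exists_lc_equivalent (hM : HasContractibleOpenBasis M) (f : LCCocycle M G) :
    ∃ ξ : CechCocycle (ContractibleOpens M)ᵒᵈ G, (ξ.lc hM f.cover).Equivalent f := by
  choose s hs hfs using f.exists_trivialization hM
  have hF := fun a b : ContractibleOpens M =>
    f.cover.exists_glue (S := a.carrier ∩ b.carrier)
      (fun c x => (s a c ⟨x, x.2.1.1, x.2.2⟩)⁻¹ * s b c ⟨x, x.2.1.2, x.2.2⟩)
      (fun c => by
        have h₁ := (hs a c).comp_continuous (f := fun x : ↥(a.carrier ∩ b.carrier ∩ c.1.carrier) =>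
          ⟨x, x.2.1.1, x.2.2⟩) (by fun_prop)
        have h₂ := (hs b c).comp_continuous (f := fun x : ↥(a.carrier ∩ b.carrier ∩ c.1.carrier) =>
          ⟨x, x.2.1.2, x.2.2⟩) (by fun_prop)
        exact h₁.inv.mul h₂)
      (fun c c' x hx hc hc' => by
        dsimp only
        rw [← hfs a c c' x hx.1 hc hc', ← hfs b c c' x hx.2 hc hc']
        group)
  choose F hF hFs using hF
  have hmul : ∀ (a a' a'' : ContractibleOpens M) (x : M) (h : x ∈ a.carrier) (h' : x ∈ a'.carrier)
      (h'' : x ∈ a''.carrier),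
      F a'' a' ⟨x, h'', h'⟩ * F a' a ⟨x, h', h⟩ = F a'' a ⟨x, h'', h⟩ := by
    intro a a' a'' x h h' h''
    have hx := f.cover.mem_index x
    rw [hFs a'' a' _ x ⟨h'', h'⟩ hx, hFs a' a _ x ⟨h', h⟩ hx, hFs a'' a _ x ⟨h'', h⟩ hx]
    group
  refine ⟨.ofLocConst F hF hmul, fun c b x => s b.1 c ⟨x, x.2.2, x.2.1⟩, fun c b => ?_,
    fun c c' b b' x hc hc' hb hb' => ?_⟩
  · exact (hs b.1 c).comp_continuous (f := fun x : ↥(c.1.carrier ∩ b.1.carrier) =>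
      (⟨x, x.2.2, x.2.1⟩ : ↥(b.1.carrier ∩ c.1.carrier))) (by fun_prop)
  · change s b.1 c ⟨x, hb, hc⟩ * lcFun hM (.ofLocConst F hF hmul) b.1 b'.1 ⟨x, hb, hb'⟩ =
      f.toFun c c' ⟨x, hc, hc'⟩ * s b'.1 c' ⟨x, hb', hc'⟩
    rw [lcFun_ofLocConst, hFs b.1 b'.1 c x ⟨hb, hb'⟩ hc, mul_inv_cancel_left]
    exact (hfs b'.1 c c' x hb' hc hc').symm

/-- The map `H¹_c(K°, G) → H¹_lc(M, G)` induced by `ξ ↦ (A, ξ^lc)`. -/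
noncomputable def CechH1.toLCH1 (hM : HasContractibleOpenBasis M) (A : ContractibleCover M) :
    CechH1 (ContractibleOpens M)ᵒᵈ G → LCH1 M G :=
  Quotient.map (fun ξ => ξ.lc hM A) fun _ _ h => CechCocycle.Equivalent.lc h hM A A

theorem CechH1.toLCH1_bijective (hM : HasContractibleOpenBasis M) (A : ContractibleCover M) :
    Function.Bijective (CechH1.toLCH1 (G := G) hM A) := by
  constructor
  · rintro ⟨ξ'⟩ ⟨ξ⟩ h
    exact Quotient.sound (CechCocycle.equivalent_of_lc hM A (Quotient.exact h))
  · rintro ⟨f⟩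
    obtain ⟨ξ, hξ⟩ := f.exists_lc_equivalent hM
    have h := (CechCocycle.equivalence.refl ξ).lc hM A f.cover
    exact ⟨ξ.toH1, Quotient.sound (LCCocycle.equivalence.trans h hξ)⟩

end PosetCech

theorem proposition6p5 (M : Type u) [TopologicalSpace M] [ParacompactSpace M]
    [PathConnectedSpace M] (hM : PosetCech.HasContractibleOpenBasis M)
    (hcov : (T2Space M ∧ LocallyCompactSpace M) ∨ Nonempty (PosetCech.ContractibleCover M))
    (G : Type v) [Group G] :
    Nonempty (PosetCech.ContractibleCover M) ∧
    ∃! Φ : PosetCech.CechH1 (PosetCech.ContractibleOpens M)ᵒᵈ G ≃ PosetCech.LCH1 M G,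
      ∀ (A : PosetCech.ContractibleCover M)
        (ξ : PosetCech.CechCocycle (PosetCech.ContractibleOpens M)ᵒᵈ G),
        Φ ξ.toH1 = (ξ.lc hM A).toH1 := by
  have hne : Nonempty (PosetCech.ContractibleCover M) := by
    rcases hcov with ⟨_, _⟩ | h
    · have := PosetCech.sigmaCompactSpace_of_paracompact_connected M
      exact hM.nonempty_contractibleCover
    · exact h
  refine ⟨hne, ?_⟩
  obtain ⟨B⟩ := hne
  refine ⟨Equiv.ofBijective _ (PosetCech.CechH1.toLCH1_bijective hM B), fun A ξ => ?_,
    fun Ψ hΨ => ?_⟩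
  · exact Quotient.sound ((PosetCech.CechCocycle.equivalence.refl ξ).lc hM B A)
  · ext ⟨ξ⟩
    exact hΨ B ξ
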